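/- Let $\omega>0$, $L>0$, $k\in\mathbb R$. For a bounded Lipschitz domain $D\subset\mathbb R^d$ put $\Omega=D\times(0,L)$ with coordinates $(x,z)$, $\Gamma_{\rm in}=D\times\{0\}$, $\Gamma_{\rm out}=D\times\{L\}$, $\Gamma_{\rm lat}=\partial D\times(0,L)$, and let $\boldsymbol n$ be the outer normal. Square roots are principal branches. *Acoustic operator.* Let $a$ be a measurable, real symmetric matrix function on $D$ with $0<\lambda_{\min}\le a\le\lambda_{\max}<\infty$, let $\mathfrak a=\operatorname{diag}(a,1)$, and let $(\varphi_n,\lambda_n)_{n}$ be the $L^2(D)$-orthonormal eigenpairs of $-\operatorname{div}(a\nabla\,\cdot)$ with homogeneous Neumann conditions, in ascending order and repeated according to multiplicity. With $\kappa_n=\sqrt{\lambda_n-\omega^2}$ let $\operatorname{DtN}p=-\sum_n\kappa_n(p,\varphi_n)_{L^2(D)}\varphi_n$, and fix a sign $\sigma\in\{1,-1\}$. Then $$A^{\rm helm}\binom{p}{\boldsymbol u}=\binom{i\omega\boldsymbol u+\mathfrak a\nabla p}{i\omega p+\operatorname{div}\boldsymbol u}$$ with domain the set of $(p,\boldsymbol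 u)\in H^1(\Omega)\times\boldsymbol H(\operatorname{div},\Omega)$ such that $p=0$ on $\Gamma_{\rm in}$, $\boldsymbol u\cdot\boldsymbol n=0$ in $H^{-1/2}(\Gamma_{\rm lat})$, and $i\omega\,\boldsymbol u\cdot\boldsymbol n-\sigma\operatorname{DtN}p=0$ in $(H^{1/2}(\Gamma_{\rm out}))'$. *Maxwell operator.* Let $d=2$, let $(\psi_i,\mu_i)$ and $(\phi_j,\lambda_j)$ be the Neumann and Dirichlet eigenpairs of $-\Delta$ on $D$ with positive eigenvalues, in ascending order and repeated according to multiplicity, with $(\nabla\psi_i)_i$ and $(\nabla\phi_j)_j$ orthonormal in $L^2(D)$. Assume $\lambda_j\neq\omega^2$ for all $j$, and put $\tilde\mu_i=\sqrt{\mu_i-\omega^2}$, $\tilde\lambda_j=\sqrt{\lambda_j-\omega^2}$. Write $\nabla\times\psi=(\partial_2\psi,-\partial_1\psi)$, $\gamma_t\boldsymbol E=\boldsymbol E\times\boldsymbol n$, $\pi_t\boldsymbol H=\boldsymbol n\times(\boldsymbol H\times\boldsymbol n)$, $\Gamma_-=\partial\Omega\setminus\overline{\Gamma_{\rm out}}$.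 Let $$\operatorname{DtN}^{\rm mw}\boldsymbol E=\sum_i-\frac{\tilde\mu_i}{i\omega}\hat\alpha_i(\boldsymbol E)\nabla\psi_i+\sum_j\frac{i\omega}{\tilde\lambda_j}\hat\beta_j(\boldsymbol E)\,\nabla\times\phi_j,$$ where $\hat\alpha_i,\hat\beta_j$ are the extensions by continuity in $\boldsymbol H(\operatorname{curl},\Omega)$ of $\boldsymbol E\mapsto(\pi_t\boldsymbol E,\nabla\times\psi_i)_{L^2(\Gamma_{\rm out})}$ and $\boldsymbol E\mapsto(\pi_t\boldsymbol E,\nabla\phi_j)_{L^2(\Gamma_{\rm out})}$ from smooth fields vanishing near $\overline{\Gamma_-}$. Then $$A^{\rm maxwell}\binom{\boldsymbol E}{\boldsymbol H}=\binom{\nabla\times\boldsymbol E-i\omega\boldsymbol H}{\nabla\times\boldsymbol H+i\omega\boldsymbol E}$$ with domain the set of $(\boldsymbol E,\boldsymbol H)\in\boldsymbol H(\operatorname{curl},\Omega)^2$ such that $\gamma_t\boldsymbol E=0$ on $\Gamma_-$ and $\pi_t\boldsymbol H=\operatorname{DtN}^{\rm mw}\boldsymbol E$ on $\Gamma_{\rm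 out}$ (as functionals on $\{\gamma_t\boldsymbol G\}$, $\boldsymbol G$ smooth and vanishing near $\overline{\Gamma_-}$). **Lemma.** Let $A\in\{A^{\rm helm},A^{\rm maxwell}\}$, and let $\tilde A\tilde u:=e^{ikz}A(e^{-ikz}\tilde u)$ with domain $D(\tilde A)=\{\tilde u\in L^2(\Omega): e^{-ikz}\tilde u\in D(A)\}$. Then $\tilde A$ is bounded below (i.e. $\|\tilde A\tilde u\|\ge\alpha\|\tilde u\|$ on $D(\tilde A)$ for some $\alpha>0$, norms in $L^2(\Omega)$) if and only if $A$ is, and the boundedness-below constants are identical: for every $\alpha\in\mathbb R$, $$\|Au\|\ge\alpha\|u\|\ \ \forall u\in D(A)\iff\|\tilde A\tilde u\|\ge\alpha\|\tilde u\|\ \ \forall\tilde u\in D(\tilde A),$$ and the best constants $\inf_{0\ne u\in D(A)}\|Au\|/\|u\|$ and $\inf_{0\ne\tilde u\in D(\tilde A)}\|\tilde A\tilde u\|/\|\tilde u\|$ coincide. -/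

import Mathlib

open MeasureTheory Set Topology
open scoped ENNReal

noncomputable section

set_option linter.unusedSectionVars false

namespace Waveguide

/-! ### Smooth fields and weak derivatives in `L²(U)` -/

/-- `L²(U; F)` for a subset `U` of a Euclidean-type space, with Lebesgue measure. -/
abbrev L2 {X : Type*} [MeasureSpace X] (U : Set X) (F : Type*) [NormedAddCommGroup F] : Type _ :=
  Lp F 2 ((volume : Measure X).restrict U)

section Calculus

variable {X : Type*} [NormedAddCommGroup X] [NormedSpace ℝ X] {ι : Type*} [Fintype ι]

/-- Smooth and compactly supported in the open set `U`. -/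
def IsTest {F : Type*} [NormedAddCommGroup F] [NormedSpace ℝ F] (U : Set X) (Φ : X → F) : Prop :=
  ContDiff ℝ (⊤ : ℕ∞) Φ ∧ HasCompactSupport Φ ∧ tsupport Φ ⊆ U

/-- Smooth and compactly supported in the whole space, and vanishing in a neighbourhood of `K`. -/
def IsSmoothOff {F : Type*} [NormedAddCommGroup F] [NormedSpace ℝ F] (K : Set X) (Φ : X → F) :
    Prop :=
  ContDiff ℝ (⊤ : ℕ∞) Φ ∧ HasCompactSupport Φ ∧ Disjoint (tsupport Φ) K

/-- Classical gradient of `v` along the coordinate directions `e j`. -/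
def grad (e : ι → X) (v : X → ℂ) (x : X) : EuclideanSpace ℂ ι :=
  WithLp.toLp 2 fun j => fderiv ℝ v x (e j)

/-- Classical divergence. -/
def div (e : ι → X) (Φ : X → EuclideanSpace ℂ ι) (x : X) : ℂ :=
  ∑ j, (fderiv ℝ Φ x (e j)) j

/-- Classical three-dimensional curl. -/
def curl (e : Fin 3 → X) (Φ : X → EuclideanSpace ℂ (Fin 3)) (x : X) : EuclideanSpace ℂ (Fin 3) :=
  !₂[(fderiv ℝ Φ x (e 1)) 2 - (fderiv ℝ Φ x (e 2)) 1,
     (fderiv ℝ Φ x (e 2)) 0 - (fderiv ℝ Φ x (e 0)) 2,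
     (fderiv ℝ Φ x (e 0)) 1 - (fderiv ℝ Φ x (e 1)) 0]

variable [MeasureSpace X]

/-- `∫_U f v` (bilinear, no conjugation). -/
def pairS (U : Set X) (f : L2 U ℂ) (v : X → ℂ) : ℂ := ∫ x in U, f x * v x

/-- `∫_U f · Φ` (bilinear, no conjugation). -/
def pairV (U : Set X) (f : L2 U (EuclideanSpace ℂ ι)) (Φ : X → EuclideanSpace ℂ ι) : ℂ :=
  ∫ x in U, ∑ j, f x j * Φ x j

/-- `g ∈ L²(U)` is the weak gradient of `f ∈ L²(U)`, i.e. `f ∈ H¹(U)` and `∇ f = g`. -/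
def HasWeakGrad (e : ι → X) (U : Set X) (f : L2 U ℂ) (g : L2 U (EuclideanSpace ℂ ι)) : Prop :=
  ∀ Φ : X → EuclideanSpace ℂ ι, IsTest U Φ → pairS U f (div e Φ) = -pairV U g Φ

/-- `g ∈ L²(U)` is the weak divergence of `u ∈ L²(U)`, i.e. `u ∈ H(div, U)` and `div u = g`. -/
def HasWeakDiv (e : ι → X) (U : Set X) (u : L2 U (EuclideanSpace ℂ ι)) (g : L2 U ℂ) : Prop :=
  ∀ v : X → ℂ, IsTest U v → pairV U u (grad e v) = -pairS U g v

/-- `C ∈ L²(U)` is the weak curl of `E ∈ L²(U)`, i.e. `E ∈ H(curl, U)` and `∇ × E = C`. -/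
def HasWeakCurl (e : Fin 3 → X) (U : Set X) (E C : L2 U (EuclideanSpace ℂ (Fin 3))) : Prop :=
  ∀ Φ : X → EuclideanSpace ℂ (Fin 3), IsTest U Φ → pairV U E (curl e Φ) = pairV U C Φ

end Calculus

section Cylinder

variable {d : ℕ}

/-- The cross-section space `ℝ^d`. -/
abbrev Cross (d : ℕ) : Type := EuclideanSpace ℝ (Fin d)

/-- The space `ℝ^d × ℝ ∋ (x, z)` containing the waveguide. -/
abbrev Space (d : ℕ) : Type := Cross d × ℝ

/-- Coordinate directions of the cross-section. -/
def crossAxes (d : ℕ) : Fin d → Cross d := fun j => EuclideanSpace.single j 1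

/-- Coordinate directions of `ℝ^d × ℝ`; the index `Sum.inr ()` is the longitudinal direction. -/
def axes (d : ℕ) : Fin d ⊕ Unit → Space d :=
  Sum.elim (fun j => (EuclideanSpace.single j 1, 0)) (fun _ => (0, 1))

/-- Coordinate directions of `ℝ² × ℝ`, numbered `0, 1, 2`; the last one is `e_z`. -/
def axes3 : Fin 3 → Space 2 :=
  ![(EuclideanSpace.single 0 1, 0), (EuclideanSpace.single 1 1, 0), (0, 1)]

/-- The waveguide `Ω = D × (0, L)`. -/
def guide (D : Set (Cross d)) (L : ℝ) : Set (Space d) := D ×ˢ Ioo 0 L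

/-- `Γ_out = D × {L}`. -/
def outflow (D : Set (Cross d)) (L : ℝ) : Set (Space d) := D ×ˢ {L}

/-- `Γ_- = ∂Ω \ closure Γ_out`. -/
def gammaMinus (D : Set (Cross d)) (L : ℝ) : Set (Space d) :=
  frontier (guide D L) \ closure (outflow D L)

/-- Bounded Lipschitz domain: a bounded connected (nonempty) open set which near each boundary
point lies, in suitable orthogonal coordinates, strictly above the graph of a Lipschitz function. -/
structure IsBoundedLipschitzDomain (D : Set (Cross d)) : Prop where
  isOpen : IsOpen D
  isConnected : IsConnected D
  isBounded : Bornology.IsBounded D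
  lipschitz : ∀ x ∈ frontier D, ∃ e : Cross d, ‖e‖ = 1 ∧ ∃ r > 0, ∃ K, ∃ γ : Cross d → ℝ,
    LipschitzWith K γ ∧
      ∀ y ∈ Metric.ball x r, (y ∈ D ↔ γ (y - (inner ℝ e y : ℝ) • e) < inner ℝ e y)

/-! ### Eigenpairs on the cross-section -/

/-- `H¹(D)`, as the set of pairs `(f, ∇ f)`. -/
def H1 (D : Set (Cross d)) : Set (L2 D ℂ × L2 D (EuclideanSpace ℂ (Fin d))) :=
  {y | HasWeakGrad (crossAxes d) D y.1 y.2}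

/-- `H¹₀(D)`, the closure of the test functions in `H¹(D)`, as the set of pairs `(f, ∇ f)`. -/
def H10 (D : Set (Cross d)) : Set (L2 D ℂ × L2 D (EuclideanSpace ℂ (Fin d))) :=
  closure {y | ∃ v : Cross d → ℂ, IsTest D v ∧
    (y.1 : Cross d → ℂ) =ᵐ[volume.restrict D] v ∧
    (y.2 : Cross d → EuclideanSpace ℂ (Fin d)) =ᵐ[volume.restrict D] grad (crossAxes d) v}

/-- `y = (φ, ∇ φ)` is a weak solution of `-div (a ∇ φ) = l φ` in the form domain `V`:
`(a ∇ φ, ∇ w) = l (φ, w)` for all `w ∈ V`. With `V = H¹(D)` this is the Neumann problem, with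
`V = H¹₀(D)` the Dirichlet problem. -/
def IsWeakEigen {D : Set (Cross d)} (V : Set (L2 D ℂ × L2 D (EuclideanSpace ℂ (Fin d))))
    (a : Cross d → Matrix (Fin d) (Fin d) ℝ) (l : ℝ)
    (y : L2 D ℂ × L2 D (EuclideanSpace ℂ (Fin d))) : Prop :=
  y ∈ V ∧ ∀ w ∈ V,
    ∫ x in D, ∑ i, (∑ j, (a x i j : ℂ) * y.2 x j) * starRingEnd ℂ (w.2 x i)
      = l * ∫ x in D, y.1 x * starRingEnd ℂ (w.1 x)

/-- The sequence `(φ n, l n)` lists the eigenpairs with eigenvalue in `Λ`, in ascending order and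
according to multiplicity: each is an eigenpair, and every eigenfunction with eigenvalue in `Λ`
is a linear combination of the listed ones with the same eigenvalue. (Normalization is separate.) -/
structure ListsEigenpairs {D : Set (Cross d)}
    (V : Set (L2 D ℂ × L2 D (EuclideanSpace ℂ (Fin d))))
    (a : Cross d → Matrix (Fin d) (Fin d) ℝ) (Λ : Set ℝ)
    (φ : ℕ → L2 D ℂ × L2 D (EuclideanSpace ℂ (Fin d))) (l : ℕ → ℝ) : Prop where
  mem : ∀ n, l n ∈ Λ
  eigen : ∀ n, IsWeakEigen V a (l n) (φ n)
  mono : Monotone l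
  exhaust : ∀ m ∈ Λ, ∀ y, IsWeakEigen V a m y → y ∈ Submodule.span ℂ {w | ∃ n, l n = m ∧ w = φ n}

/-- `sqrt (l - ω²)`, principal branch. -/
def kappa (ω l : ℝ) : ℂ := ((l - ω ^ 2 : ℝ) : ℂ) ^ (1 / 2 : ℂ)

/-! ### The acoustic waveguide operator -/

/-- The coefficient `a` is measurable, pointwise symmetric and uniformly bounded and positive
definite on `D`. -/
structure IsElliptic (D : Set (Cross d)) (a : Cross d → Matrix (Fin d) (Fin d) ℝ) : Prop where
  measurable : ∀ i j, AEMeasurable (fun x => a x i j) (volume.restrict D)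
  symm : ∀ x ∈ D, (a x).IsSymm
  bounds : ∃ lmin lmax : ℝ, 0 < lmin ∧ ∀ x ∈ D, ∀ ξ : Fin d → ℝ,
    lmin * (ξ ⬝ᵥ ξ) ≤ ξ ⬝ᵥ (a x).mulVec ξ ∧ ξ ⬝ᵥ (a x).mulVec ξ ≤ lmax * (ξ ⬝ᵥ ξ)

/-- The block matrix `𝔞 = diag (a, 1)`. -/
def bigA (a : Cross d → Matrix (Fin d) (Fin d) ℝ) (x : Cross d) :
    Matrix (Fin d ⊕ Unit) (Fin d ⊕ Unit) ℂ :=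
  Matrix.fromBlocks ((a x).map Complex.ofReal) 0 0 1

/-- For `p ∈ H¹(Ω)` with gradient `g`: the traces of `p` at `z = 0` and `z = L` are `t₀` and `t₁`.
They are characterized by Green's formula
`∫_Ω p ∂_z v + ∂_z p v = ∫_D t₁ v(·, L) - ∫_D t₀ v(·, 0)`, `v` smooth up to the boundary. -/
def HasTraces (D : Set (Cross d)) (L : ℝ) (p : L2 (guide D L) ℂ)
    (g : L2 (guide D L) (EuclideanSpace ℂ (Fin d ⊕ Unit))) (t₀ t₁ : L2 D ℂ) : Prop :=
  ∀ v : Space d → ℂ, ContDiff ℝ (⊤ : ℕ∞) v → HasCompactSupport v →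
    pairS (guide D L) p (fun x => fderiv ℝ v x (0, 1))
      + pairV (guide D L) g (fun x => EuclideanSpace.single (Sum.inr ()) (v x))
      = pairS D t₁ (fun x => v (x, L)) - pairS D t₀ (fun x => v (x, 0))

/-- The pairing `⟨u · n, v⟩_∂Ω = (u, ∇ v)_Ω + (div u, v)_Ω` of the normal trace of
`u ∈ H(div, Ω)`, `div u = δ`, with (the trace of) `v ∈ H¹(Ω)`, `∇ v = g`
(antilinear in `v`; Mathlib's `inner` is antilinear in its first argument). -/
def normalPairing {D : Set (Cross d)} {L : ℝ}
    (u : L2 (guide D L) (EuclideanSpace ℂ (Fin d ⊕ Unit))) (δ : L2 (guide D L) ℂ)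
    (v : L2 (guide D L) ℂ) (g : L2 (guide D L) (EuclideanSpace ℂ (Fin d ⊕ Unit))) : ℂ :=
  inner ℂ g u + inner ℂ v δ

/-- `u · n = 0` in `H^{-1/2}(Γ_lat)`: the normal trace vanishes on all traces supported in
`Γ_lat`. -/
def NormalZeroLat {D : Set (Cross d)} {L : ℝ}
    (u : L2 (guide D L) (EuclideanSpace ℂ (Fin d ⊕ Unit))) (δ : L2 (guide D L) ℂ) : Prop :=
  ∀ v g, HasWeakGrad (axes d) (guide D L) v g → HasTraces D L v g 0 0 → normalPairing u δ v g = 0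

/-- `iω u · n - σ DtN p = 0` in the dual of `H^{1/2}(Γ_out)`, where `t = p|_{Γ_out}` and
`DtN t = - ∑ n, κ_n (t, φ_n) φ_n`; `σ` is a sign. The test functions run through the traces on
`Γ_out` of functions in `H¹(Ω)` vanishing on `Γ_in`. -/
def OutflowHelm {D : Set (Cross d)} {L : ℝ} (σ ω : ℝ) (φ : ℕ → L2 D ℂ) (l : ℕ → ℝ)
    (u : L2 (guide D L) (EuclideanSpace ℂ (Fin d ⊕ Unit))) (δ : L2 (guide D L) ℂ)
    (t : L2 D ℂ) : Prop :=
  ∀ v g s, HasWeakGrad (axes d) (guide D L) v g → HasTraces D L v g 0 s →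
    HasSum (fun n => σ * -(kappa ω (l n) * inner ℂ (φ n) t * inner ℂ s (φ n)))
      (Complex.I * ω * normalPairing u δ v g)

/-- `L²(Ω)`-pairs `(p, u)`. -/
abbrev HelmState (D : Set (Cross d)) (L : ℝ) : Type :=
  WithLp 2 (L2 (guide D L) ℂ × L2 (guide D L) (EuclideanSpace ℂ (Fin d ⊕ Unit)))

/-- `L²(Ω)`-pairs of right-hand sides of the acoustic system. -/
abbrev HelmData (D : Set (Cross d)) (L : ℝ) : Type :=
  WithLp 2 (L2 (guide D L) (EuclideanSpace ℂ (Fin d ⊕ Unit)) × L2 (guide D L) ℂ)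

/-- `(p, u) ∈ D(A^helm)` (the boundary conditions being `p = 0` on `Γ_in`, `u · n = 0` on `Γ_lat`,
`iω u · n = σ DtN p` on `Γ_out`) and `A^helm (p, u) = (iω u + 𝔞 ∇ p, iω p + div u) = (F, f)`. -/
def HelmRel (D : Set (Cross d)) (L σ ω : ℝ) (a : Cross d → Matrix (Fin d) (Fin d) ℝ)
    (φ : ℕ → L2 D ℂ) (l : ℕ → ℝ) (y : HelmState D L × HelmData D L) : Prop :=
  ∃ g δ t, HasWeakGrad (axes d) (guide D L) y.1.fst g ∧
    HasWeakDiv (axes d) (guide D L) y.1.snd δ ∧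
    HasTraces D L y.1.fst g 0 t ∧
    NormalZeroLat y.1.snd δ ∧
    OutflowHelm σ ω φ l y.1.snd δ t ∧
    (∀ᵐ x ∂(volume.restrict (guide D L)), ∀ j, y.2.fst x j =
      Complex.I * ω * y.1.snd x j + (bigA a x.1).mulVec (g x) j) ∧
    y.2.snd = (Complex.I * ω) • y.1.fst + δ

/-! ### The Maxwell waveguide operator -/

/-- Vector fields in `L²(Ω)³`. -/
abbrev Field (D : Set (Cross 2)) (L : ℝ) : Type := L2 (guide D L) (EuclideanSpace ℂ (Fin 3))

/-- `w ↦ (w₂, -w₁)`. On `Γ_out`, with outer normal `e_z`, this is `w × e_z`; moreover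
`∇ × ψ = perp (∇ ψ)` is the two-dimensional curl of a scalar function. -/
def perp : EuclideanSpace ℂ (Fin 2) →L[ℂ] EuclideanSpace ℂ (Fin 2) :=
  LinearMap.toContinuousLinearMap
    { toFun := fun w => !₂[w 1, -w 0]
      map_add' := by
        intro v w; ext i; fin_cases i <;> simp [add_comm]
      map_smul' := by
        intro c w; ext i; fin_cases i <;> simp }

/-- Transversal components. -/
def tang : EuclideanSpace ℂ (Fin 3) →L[ℂ] EuclideanSpace ℂ (Fin 2) :=
  LinearMap.toContinuousLinearMap
    { toFun := fun w => !₂[w 0, w 1]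
      map_add' := by
        intro v w; ext i; fin_cases i <;> simp
      map_smul' := by
        intro c w; ext i; fin_cases i <;> simp }

/-- For `E ∈ H(curl, Ω)` with curl `C`: `γ_t E = 0` on `Γ_-`, i.e. Green's formula holds without
boundary term for all smooth fields vanishing in a neighbourhood of the closure of `Γ_out`. -/
def TangentialZero {D : Set (Cross 2)} {L : ℝ} (E C : Field D L) : Prop :=
  ∀ Φ : Space 2 → EuclideanSpace ℂ (Fin 3), IsSmoothOff (closure (outflow D L)) Φ →
    pairV (guide D L) E (curl axes3 Φ) = pairV (guide D L) C Φ

/-- `E` is (the class of) a field that is smooth up to the boundary and vanishes in a neighbourhood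
of the closure of `Γ_-`, `C` is its curl, and `τ` is its tangential component on `Γ_out`. -/
def SmoothTriple (D : Set (Cross 2)) (L : ℝ) (E C : Field D L)
    (τ : L2 D (EuclideanSpace ℂ (Fin 2))) : Prop :=
  ∃ Φ : Space 2 → EuclideanSpace ℂ (Fin 3), IsSmoothOff (closure (gammaMinus D L)) Φ ∧
    (E : Space 2 → EuclideanSpace ℂ (Fin 3)) =ᵐ[volume.restrict (guide D L)] Φ ∧
    (C : Space 2 → EuclideanSpace ℂ (Fin 3)) =ᵐ[volume.restrict (guide D L)] curl axes3 Φ ∧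
    (τ : Cross 2 → EuclideanSpace ℂ (Fin 2)) =ᵐ[volume.restrict D] fun x => tang (Φ (x, L))

/-- `OutCoeff w E C c` says that `c` is the value at `E` (with curl `C`) of the extension by
continuity of the functional `E ↦ (π_t E, w)_{L²(Γ_out)}` from the smooth fields vanishing near
`Γ_-` to their closure `H_{0,Γ_-}(curl, Ω)` in `H(curl, Ω)`. -/
def OutCoeff {D : Set (Cross 2)} {L : ℝ} (w : L2 D (EuclideanSpace ℂ (Fin 2)))
    (E C : Field D L) (c : ℂ) : Prop :=
  (E, C, c) ∈ closure {y : Field D L × Field D L × ℂ |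
    ∃ τ, SmoothTriple D L y.1 y.2.1 τ ∧ y.2.2 = inner ℂ w τ}

/-- `π_t H = DtN^mw E` on `Γ_out`, where `gψ i = ∇ ψ_i`, `gφ j = ∇ φ_j`,
`α i = (π_t E, ∇ × ψ_i)`, `β j = (π_t E, ∇ φ_j)` and
`DtN^mw E = ∑ i, -(μ̃_i / (iω)) α_i ∇ ψ_i + ∑ j, (iω / λ̃_j) β_j ∇ × φ_j`.
Both sides are tested with `γ_t G`, `G` smooth and vanishing near `Γ_-`, and
`⟨π_t H, γ_t G⟩ = (∇ × H, G) - (H, ∇ × G)`. -/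
def OutflowMaxwell {D : Set (Cross 2)} {L : ℝ} (ω : ℝ)
    (gψ : ℕ → L2 D (EuclideanSpace ℂ (Fin 2))) (μ : ℕ → ℝ)
    (gφ : ℕ → L2 D (EuclideanSpace ℂ (Fin 2))) (l : ℕ → ℝ)
    (E cE H cH : Field D L) : Prop :=
  ∃ α β : ℕ → ℂ, (∀ i, OutCoeff (perp.compLp (gψ i)) E cE (α i)) ∧
    (∀ j, OutCoeff (gφ j) E cE (β j)) ∧
    ∀ G cG τ, SmoothTriple D L G cG τ → ∃ s₁ s₂,
      HasSum (fun i => -(kappa ω (μ i) / (Complex.I * ω)) * α i *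
        inner ℂ (perp.compLp τ) (gψ i)) s₁ ∧
      HasSum (fun j => Complex.I * ω / kappa ω (l j) * β j *
        inner ℂ (perp.compLp τ) (perp.compLp (gφ j))) s₂ ∧
      inner ℂ G cH - inner ℂ cG H = s₁ + s₂

/-- `L²(Ω)`-pairs `(E, H)`. -/
abbrev MaxwellState (D : Set (Cross 2)) (L : ℝ) : Type := WithLp 2 (Field D L × Field D L)

/-- `(E, H) ∈ D(A^maxwell)` and `A^maxwell (E, H) = (∇ × E - iω H, ∇ × H + iω E) = (F, G)`. -/
def MaxwellRel (D : Set (Cross 2)) (L ω : ℝ)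
    (gψ : ℕ → L2 D (EuclideanSpace ℂ (Fin 2))) (μ : ℕ → ℝ)
    (gφ : ℕ → L2 D (EuclideanSpace ℂ (Fin 2))) (l : ℕ → ℝ)
    (y : MaxwellState D L × MaxwellState D L) : Prop :=
  ∃ cE cH, HasWeakCurl axes3 (guide D L) y.1.fst cE ∧
    HasWeakCurl axes3 (guide D L) y.1.snd cH ∧
    TangentialZero y.1.fst cE ∧
    OutflowMaxwell ω gψ μ gφ l y.1.fst cE y.1.snd cH ∧
    y.2.fst = cE - (Complex.I * ω) • y.1.snd ∧
    y.2.snd = cH + (Complex.I * ω) • y.1.fst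

end Cylinder

/-! ### Linearity and single-valuedness of the differential relations -/

section Helpers

variable {X : Type*} [NormedAddCommGroup X] [NormedSpace ℝ X] {ι : Type*} [Fintype ι]

/-- The weights against which `L²` functions are paired. -/
def IsWeight {F : Type*} [NormedAddCommGroup F] (w : X → F) : Prop :=
  Continuous w ∧ HasCompactSupport w

lemma IsWeight.comp {F G : Type*} [NormedAddCommGroup F] [NormedAddCommGroup G] {w : X → F}
    (h : IsWeight w) (T : F → G) (hT : Continuous T) (h0 : T 0 = 0) :
    IsWeight (fun x => T (w x)) :=
  ⟨hT.comp h.1, h.2.comp_left h0⟩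

lemma isWeight_fderiv {F : Type*} [NormedAddCommGroup F] [NormedSpace ℝ F] {w : X → F}
    (h : ContDiff ℝ (⊤ : ℕ∞) w) (hc : HasCompactSupport w) : IsWeight (fderiv ℝ w) :=
  ⟨h.continuous_fderiv (by simp), hc.fderiv (𝕜 := ℝ)⟩

lemma isWeight_grad (e : ι → X) {v : X → ℂ} (h : ContDiff ℝ (⊤ : ℕ∞) v)
    (hc : HasCompactSupport v) : IsWeight (grad e v) :=
  (isWeight_fderiv h hc).comp (fun T => WithLp.toLp 2 fun j => T (e j)) (by fun_prop)
    (by ext; simp)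

lemma isWeight_div (e : ι → X) {v : X → EuclideanSpace ℂ ι} (h : ContDiff ℝ (⊤ : ℕ∞) v)
    (hc : HasCompactSupport v) : IsWeight (div e v) :=
  (isWeight_fderiv h hc).comp (fun T => ∑ j, (T (e j)) j) (by fun_prop) (by simp)

lemma isWeight_curl (e : Fin 3 → X) {v : X → EuclideanSpace ℂ (Fin 3)}
    (h : ContDiff ℝ (⊤ : ℕ∞) v) (hc : HasCompactSupport v) : IsWeight (curl e v) :=
  (isWeight_fderiv h hc).comp (fun T => !₂[(T (e 1)) 2 - (T (e 2)) 1,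
     (T (e 2)) 0 - (T (e 0)) 2, (T (e 0)) 1 - (T (e 1)) 0]) 
     (by
       refine (PiLp.continuous_toLp 2 _).comp (continuous_pi fun i => ?_)
       fin_cases i <;> simp <;> fun_prop) 
     (by ext i; fin_cases i <;> simp)

variable [MeasureSpace X] [BorelSpace X] [IsFiniteMeasureOnCompacts (volume : Measure X)]
  {U : Set X}

lemma integrable_pairS (f : L2 U ℂ) {v : X → ℂ} (hv : IsWeight v) :
    Integrable (fun x => f x * v x) (volume.restrict U) :=
  (Lp.memLp f).integrable_mul (q := 2) (hv.1.memLp_of_hasCompactSupport hv.2)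

lemma integrable_pairV (f : L2 U (EuclideanSpace ℂ ι)) {v : X → EuclideanSpace ℂ ι}
    (hv : IsWeight v) : Integrable (fun x => ∑ j, f x j * v x j) (volume.restrict U) := by
  refine integrable_finsetSum _ fun j _ => ?_
  have hj := hv.comp (fun w => w j) (by fun_prop) (by simp)
  exact ((memLp_piLp_iff.1 (Lp.memLp f)) j).integrable_mul (q := 2)
    (hj.1.memLp_of_hasCompactSupport hj.2)

lemma pairS_add (f g : L2 U ℂ) {v : X → ℂ} (hv : IsWeight v) :
    pairS U (f + g) v = pairS U f v + pairS U g v := by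
  unfold pairS
  rw [← integral_add (integrable_pairS f hv) (integrable_pairS g hv)]
  refine integral_congr_ae ?_
  filter_upwards [Lp.coeFn_add f g] with x hx
  rw [hx]; simp [add_mul]

lemma pairS_smul (c : ℂ) (f : L2 U ℂ) (v : X → ℂ) : pairS U (c • f) v = c * pairS U f v := by
  unfold pairS
  rw [← integral_const_mul]
  refine integral_congr_ae ?_
  filter_upwards [Lp.coeFn_smul c f] with x hx
  rw [hx]; simp [mul_assoc]

lemma pairS_zero (v : X → ℂ) : pairS U 0 v = 0 := by
  simpa using pairS_smul (U := U) 0 0 v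

lemma pairV_add (f g : L2 U (EuclideanSpace ℂ ι)) {v : X → EuclideanSpace ℂ ι}
    (hv : IsWeight v) : pairV U (f + g) v = pairV U f v + pairV U g v := by
  unfold pairV
  rw [← integral_add (integrable_pairV f hv) (integrable_pairV g hv)]
  refine integral_congr_ae ?_
  filter_upwards [Lp.coeFn_add f g] with x hx
  rw [hx]; simp [add_mul, Finset.sum_add_distrib]

lemma pairV_smul (c : ℂ) (f : L2 U (EuclideanSpace ℂ ι)) (v : X → EuclideanSpace ℂ ι) :
    pairV U (c • f) v = c * pairV U f v := by
  unfold pairV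
  rw [← integral_const_mul]
  refine integral_congr_ae ?_
  filter_upwards [Lp.coeFn_smul c f] with x hx
  rw [hx]; simp [mul_assoc, Finset.mul_sum]

lemma pairV_zero (v : X → EuclideanSpace ℂ ι) : pairV U 0 v = 0 := by
  simpa using pairV_smul (U := U) 0 0 v

lemma ae_zero_of_test [FiniteDimensional ℝ X] (hU : IsOpen U) {f : X → ℂ}
    (hf : MemLp f 2 (volume.restrict U))
    (h : ∀ g : X → ℝ, ContDiff ℝ (⊤ : ℕ∞) g → HasCompactSupport g → tsupport g ⊆ U →
      ∫ x in U, f x * (g x : ℂ) = 0) : f =ᵐ[volume.restrict U] 0 := by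
  have := hU.ae_eq_zero_of_integral_contDiff_smul_eq_zero (μ := (volume : Measure X)) (f := f)
    (locallyIntegrableOn_of_locallyIntegrable_restrict (hf.locallyIntegrable (by norm_num))) ?_
  · exact (ae_restrict_iff' hU.measurableSet).2 this
  · intro g hg hgc hgs
    rw [← h g hg hgc hgs, ← setIntegral_eq_integral_of_forall_compl_eq_zero (s := U)]
    · simp [mul_comm]
    · intro x hx
      have : g x = 0 := image_eq_zero_of_notMem_tsupport fun h => hx (hgs h)
      simp [this]

lemma IsTest.map {F G : Type*} [NormedAddCommGroup F] [NormedSpace ℝ F] [NormedAddCommGroup G]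
    [NormedSpace ℝ G] {g : X → F} (h : IsTest U g) (T : F →L[ℝ] G) :
    IsTest U (fun x => T (g x)) :=
  ⟨T.contDiff.comp h.1, h.2.1.comp_left (map_zero T),
    (closure_mono (Function.support_comp_subset (map_zero T) g)).trans h.2.2⟩

/-- An `L²` function orthogonal to all test functions vanishes. -/
lemma eq_zero_of_pairS [FiniteDimensional ℝ X] (hU : IsOpen U) (f : L2 U ℂ)
    (h : ∀ v, IsTest U v → pairS U f v = 0) : f = 0 :=
  Lp.ext <| ((ae_zero_of_test hU (Lp.memLp f) fun _ h₁ h₂ h₃ =>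
    h _ (IsTest.map ⟨h₁, h₂, h₃⟩ Complex.ofRealCLM))).trans (Lp.coeFn_zero _ _ _).symm

/-- An `L²` field orthogonal to all test fields vanishes. -/
lemma eq_zero_of_pairV [FiniteDimensional ℝ X] (hU : IsOpen U) (f : L2 U (EuclideanSpace ℂ ι))
    (h : ∀ Φ, IsTest U Φ → pairV U f Φ = 0) : f = 0 := by
  classical
  have key : ∀ j, (fun x => f x j) =ᵐ[volume.restrict U] 0 := by
    intro j
    refine ae_zero_of_test hU (memLp_piLp_iff.1 (Lp.memLp f) j) fun g h₁ h₂ h₃ => ?_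
    have := h _ (IsTest.map ⟨h₁, h₂, h₃⟩
      (LinearMap.toContinuousLinearMap
        { toFun := fun r : ℝ => (EuclideanSpace.single j (r : ℂ) : EuclideanSpace ℂ ι)
          map_add' := by intro r s; ext i; by_cases hi : i = j <;> simp [hi]
          map_smul' := by intro r s; ext i; by_cases hi : i = j <;> simp [hi] }))
    rw [← this, pairV]
    congr 1 with x
    rw [Finset.sum_eq_single j] <;> simp +contextual
  refine Lp.ext ((?_ : f =ᵐ[_] 0).trans (Lp.coeFn_zero _ _ _).symm)
  filter_upwards [ae_all_iff.2 key] with x hx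
  ext j
  simpa using hx j

lemma HasWeakGrad.add {e : ι → X} {f f' : L2 U ℂ} {g g' : L2 U (EuclideanSpace ℂ ι)}
    (h : HasWeakGrad e U f g) (h' : HasWeakGrad e U f' g') :
    HasWeakGrad e U (f + f') (g + g') := fun Φ hΦ => by
  rw [pairS_add _ _ (isWeight_div e hΦ.1 hΦ.2.1), pairV_add _ _ ⟨hΦ.1.continuous, hΦ.2.1⟩,
    h Φ hΦ, h' Φ hΦ]
  ring

lemma HasWeakGrad.smul {e : ι → X} {f : L2 U ℂ} {g : L2 U (EuclideanSpace ℂ ι)} (c : ℂ)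
    (h : HasWeakGrad e U f g) : HasWeakGrad e U (c • f) (c • g) := fun Φ hΦ => by
  rw [pairS_smul, pairV_smul, h Φ hΦ]
  ring

lemma HasWeakGrad.eq_zero [FiniteDimensional ℝ X] (hU : IsOpen U) {e : ι → X}
    {g : L2 U (EuclideanSpace ℂ ι)} (h : HasWeakGrad e U 0 g) : g = 0 :=
  eq_zero_of_pairV hU g fun Φ hΦ => by
    have := h Φ hΦ
    rwa [pairS_zero, eq_comm, neg_eq_zero] at this

lemma HasWeakDiv.add {e : ι → X} {u u' : L2 U (EuclideanSpace ℂ ι)} {g g' : L2 U ℂ}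
    (h : HasWeakDiv e U u g) (h' : HasWeakDiv e U u' g') :
    HasWeakDiv e U (u + u') (g + g') := fun v hv => by
  rw [pairV_add _ _ (isWeight_grad e hv.1 hv.2.1), pairS_add _ _ ⟨hv.1.continuous, hv.2.1⟩,
    h v hv, h' v hv]
  ring

lemma HasWeakDiv.smul {e : ι → X} {u : L2 U (EuclideanSpace ℂ ι)} {g : L2 U ℂ} (c : ℂ)
    (h : HasWeakDiv e U u g) : HasWeakDiv e U (c • u) (c • g) := fun v hv => by
  rw [pairS_smul, pairV_smul, h v hv]
  ring

lemma HasWeakDiv.eq_zero [FiniteDimensional ℝ X] (hU : IsOpen U) {e : ι → X}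
    {g : L2 U ℂ} (h : HasWeakDiv e U 0 g) : g = 0 :=
  eq_zero_of_pairS hU g fun v hv => by
    have := h v hv
    rwa [pairV_zero, eq_comm, neg_eq_zero] at this

lemma HasWeakCurl.add {e : Fin 3 → X} {f f' g g' : L2 U (EuclideanSpace ℂ (Fin 3))}
    (h : HasWeakCurl e U f g) (h' : HasWeakCurl e U f' g') :
    HasWeakCurl e U (f + f') (g + g') := fun Φ hΦ => by
  rw [pairV_add _ _ (isWeight_curl e hΦ.1 hΦ.2.1), pairV_add _ _ ⟨hΦ.1.continuous, hΦ.2.1⟩,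
    h Φ hΦ, h' Φ hΦ]

lemma HasWeakCurl.smul {e : Fin 3 → X} {f g : L2 U (EuclideanSpace ℂ (Fin 3))} (c : ℂ)
    (h : HasWeakCurl e U f g) : HasWeakCurl e U (c • f) (c • g) := fun Φ hΦ => by
  rw [pairV_smul, pairV_smul, h Φ hΦ]

lemma HasWeakCurl.eq_zero [FiniteDimensional ℝ X] (hU : IsOpen U) {e : Fin 3 → X}
    {g : L2 U (EuclideanSpace ℂ (Fin 3))} (h : HasWeakCurl e U 0 g) : g = 0 :=
  eq_zero_of_pairV hU g fun Φ hΦ => by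
    have := h Φ hΦ
    rwa [pairV_zero, eq_comm] at this

end Helpers

/-! ### The operators as unbounded linear operators -/

section Operators

variable {d : ℕ}

lemma isWeight_slice {F : Type*} [NormedAddCommGroup F] {v : Space d → F} (h : IsWeight v)
    (z : ℝ) : IsWeight (fun x : Cross d => v (x, z)) := by
  refine ⟨h.1.comp (by fun_prop), h.2.comp_isClosedEmbedding (g := fun x : Cross d => (x, z)) ?_⟩
  exact (Isometry.of_dist_eq fun x y => by simp [Prod.dist_eq]).isClosedEmbedding

lemma HasTraces.add {D : Set (Cross d)} {L : ℝ} {p p' : L2 (guide D L) ℂ}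
    {g g' : L2 (guide D L) (EuclideanSpace ℂ (Fin d ⊕ Unit))} {s s' t t' : L2 D ℂ}
    (h : HasTraces D L p g s t) (h' : HasTraces D L p' g' s' t') :
    HasTraces D L (p + p') (g + g') (s + s') (t + t') := fun v hv hc => by
  have hw : IsWeight v := ⟨hv.continuous, hc⟩
  have h₁ : IsWeight (fun x => fderiv ℝ v x (0, 1)) :=
    (isWeight_fderiv hv hc).comp (fun T => T (0, 1)) (by fun_prop) (by simp)
  have h₂ : IsWeight (fun x => (EuclideanSpace.single (Sum.inr ()) (v x) :
      EuclideanSpace ℂ (Fin d ⊕ Unit))) :=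
    hw.comp (fun r => EuclideanSpace.single (Sum.inr ()) r)
      ((PiLp.continuous_toLp 2 _).comp (continuous_single (A := fun _ : Fin d ⊕ Unit => ℂ) _))
      (by simp)
  rw [pairS_add _ _ h₁, pairV_add _ _ h₂, pairS_add _ _ (isWeight_slice hw L),
    pairS_add _ _ (isWeight_slice hw 0)]
  linear_combination h v hv hc + h' v hv hc

lemma HasTraces.smul {D : Set (Cross d)} {L : ℝ} {p : L2 (guide D L) ℂ}
    {g : L2 (guide D L) (EuclideanSpace ℂ (Fin d ⊕ Unit))} {s t : L2 D ℂ} (c : ℂ)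
    (h : HasTraces D L p g s t) : HasTraces D L (c • p) (c • g) (c • s) (c • t) :=
  fun v hv hc => by
    rw [pairS_smul, pairV_smul, pairS_smul, pairS_smul]
    linear_combination c * h v hv hc

lemma isOpen_guide {D : Set (Cross d)} (hD : IsOpen D) (L : ℝ) : IsOpen (guide D L) :=
  hD.prod isOpen_Ioo

/-- The graph of `A^helm`. -/
def helmGraph (D : Set (Cross d)) (L σ ω : ℝ) (a : Cross d → Matrix (Fin d) (Fin d) ℝ)
    (φ : ℕ → L2 D ℂ) (l : ℕ → ℝ) : Submodule ℂ (HelmState D L × HelmData D L) where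
  carrier := {y | HelmRel D L σ ω a φ l y}
  zero_mem' := by
    refine ⟨0, 0, 0, ?_, ?_, ?_, ?_, ?_, ?_, ?_⟩
    · intro Φ _; simp [pairS_zero, pairV_zero]
    · intro Φ _; simp [pairS_zero, pairV_zero]
    · intro v _ _; simp [pairS_zero, pairV_zero]
    · intro v g _ _; simp [normalPairing]
    · intro v g s _ _; simp [normalPairing, hasSum_zero]
    · filter_upwards [AEEqFun.coeFn_zero (μ := volume.restrict (guide D L))
        (β := EuclideanSpace ℂ (Fin d ⊕ Unit))] with x h₁ j
      simp [h₁]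
    · simp
  add_mem' := by
    rintro y y' ⟨g, δ, t, h₁, h₂, h₃, h₄, h₅, h₆, h₇⟩ ⟨g', δ', t', k₁, k₂, k₃, k₄, k₅, k₆, k₇⟩
    refine ⟨g + g', δ + δ', t + t', h₁.add k₁, h₂.add k₂, ?_, ?_, ?_, ?_, ?_⟩
    · simpa using h₃.add k₃
    · intro v w hv hw
      have e₁ := h₄ v w hv hw
      have e₂ := k₄ v w hv hw
      simp only [normalPairing] at e₁ e₂ ⊢
      simp only [Prod.fst_add, WithLp.add_snd, inner_add_right]
      linear_combination e₁ + e₂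
    · intro v w s hv hw
      convert (h₅ v w s hv hw).add (k₅ v w s hv hw) using 1
      · ext n; simp only [inner_add_right]; ring
      · simp only [normalPairing, Prod.fst_add, WithLp.add_snd, inner_add_right]; ring
    · filter_upwards [h₆, k₆, Lp.coeFn_add y.2.fst y'.2.fst, Lp.coeFn_add y.1.snd y'.1.snd,
        Lp.coeFn_add g g'] with x e₁ e₂ e₃ e₄ e₅ j
      simp only [Prod.snd_add, WithLp.add_fst, Prod.fst_add, WithLp.add_snd, e₃, e₄, e₅,
        Pi.add_apply, PiLp.add_apply, e₁ j, e₂ j, WithLp.ofLp_add, Matrix.mulVec_add]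
      ring
    · simp only [Prod.snd_add, Prod.fst_add, WithLp.add_fst, WithLp.add_snd, h₇, k₇, smul_add]
      abel
  smul_mem' := by
    rintro c y ⟨g, δ, t, h₁, h₂, h₃, h₄, h₅, h₆, h₇⟩
    refine ⟨c • g, c • δ, c • t, h₁.smul c, h₂.smul c, ?_, ?_, ?_, ?_, ?_⟩
    · simpa using h₃.smul c
    · intro v w hv hw
      have e₁ := h₄ v w hv hw
      simp only [normalPairing] at e₁ ⊢
      simp only [Prod.smul_fst, WithLp.smul_snd, inner_smul_right]
      linear_combination c * e₁
    · intro v w s hv hw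
      have e := (h₅ v w s hv hw).mul_left c
      simp only [normalPairing, Prod.smul_fst, WithLp.smul_snd, inner_smul_right] at e ⊢
      refine Eq.mp (congrArg₂ (fun (f : ℕ → ℂ) (r : ℂ) => HasSum f r) (funext fun n => ?_) ?_) e
        <;> ring
    · filter_upwards [h₆, Lp.coeFn_smul c y.2.fst, Lp.coeFn_smul c y.1.snd,
        Lp.coeFn_smul c g] with x e₁ e₃ e₄ e₅ j
      simp only [Prod.smul_snd, WithLp.smul_fst, Prod.smul_fst, WithLp.smul_snd, e₃, e₄, e₅,
        Pi.smul_apply, PiLp.smul_apply, e₁ j, WithLp.ofLp_smul, Matrix.mulVec_smul, smul_eq_mul]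
      ring
    · simp only [Prod.smul_snd, Prod.smul_fst, WithLp.smul_fst, WithLp.smul_snd, h₇, smul_add]
      rw [smul_comm]

lemma helmGraph_single {D : Set (Cross d)} (hD : IsOpen D) (L σ ω : ℝ)
    (a : Cross d → Matrix (Fin d) (Fin d) ℝ) (φ : ℕ → L2 D ℂ) (l : ℕ → ℝ) :
    ∀ y ∈ helmGraph D L σ ω a φ l, y.1 = 0 → y.2 = 0 := by
  rintro ⟨u, F⟩ ⟨g, δ, t, h₁, h₂, -, -, -, h₆, h₇⟩ rfl
  have hg : g = 0 := HasWeakGrad.eq_zero (isOpen_guide hD L) h₁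
  have hδ : δ = 0 := HasWeakDiv.eq_zero (isOpen_guide hD L) h₂
  subst hg hδ
  have hF : F.fst = 0 := by
    refine Lp.ext ?_
    filter_upwards [h₆, AEEqFun.coeFn_zero (μ := volume.restrict (guide D L))
      (β := EuclideanSpace ℂ (Fin d ⊕ Unit))] with x e₁ e₂
    ext j
    simpa [e₂] using e₁ j
  have hf : F.snd = 0 := by simpa using h₇
  exact (WithLp.ofLp_injective 2) (Prod.ext hF hf)

/-- The acoustic waveguide operator `A^helm` with domain `D(A^helm)`. -/
def helmOp (D : Set (Cross d)) (L σ ω : ℝ) (a : Cross d → Matrix (Fin d) (Fin d) ℝ)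
    (φ : ℕ → L2 D ℂ) (l : ℕ → ℝ) : HelmState D L →ₗ.[ℂ] HelmData D L :=
  (helmGraph D L σ ω a φ l).toLinearPMap

/-- The graph of `helmOp` is the relation `HelmRel`. -/
theorem mem_graph_helmOp {D : Set (Cross d)} (hD : IsOpen D) (L σ ω : ℝ)
    (a : Cross d → Matrix (Fin d) (Fin d) ℝ) (φ : ℕ → L2 D ℂ) (l : ℕ → ℝ)
    (y : HelmState D L × HelmData D L) :
    y ∈ (helmOp D L σ ω a φ l).graph ↔ HelmRel D L σ ω a φ l y := by
  rw [helmOp, Submodule.toLinearPMap_graph_eq _ fun y hy h => helmGraph_single hD L σ ω a φ l y hy h]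
  rfl

lemma smoothTriple_zero (D : Set (Cross 2)) (L : ℝ) : SmoothTriple D L 0 0 0 := by
  have hc : curl axes3 (fun _ => 0) = fun _ => 0 := by
    ext x i; fin_cases i <;> simp [curl]
  refine ⟨fun _ => 0, ⟨contDiff_const, HasCompactSupport.zero, by simp [tsupport]⟩, ?_, ?_, ?_⟩
  · exact Lp.coeFn_zero _ _ _
  · rw [hc]; exact Lp.coeFn_zero _ _ _
  · simp only [map_zero]; exact Lp.coeFn_zero _ _ _

lemma curl_add {Φ Ψ : Space 2 → EuclideanSpace ℂ (Fin 3)} (h : Differentiable ℝ Φ)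
    (h' : Differentiable ℝ Ψ) (x : Space 2) :
    curl axes3 (Φ + Ψ) x = curl axes3 Φ x + curl axes3 Ψ x := by
  simp only [curl, fderiv_add (h x) (h' x)]
  ext i; fin_cases i <;> simp <;> ring

lemma curl_smul (c : ℂ) {Φ : Space 2 → EuclideanSpace ℂ (Fin 3)} (h : Differentiable ℝ Φ)
    (x : Space 2) : curl axes3 (c • Φ) x = c • curl axes3 Φ x := by
  simp only [curl, fderiv_const_smul (h x)]
  ext i; fin_cases i <;> simp <;> ring

lemma SmoothTriple.add {D : Set (Cross 2)} {L : ℝ} {E E' C C' : Field D L}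
    {τ τ' : L2 D (EuclideanSpace ℂ (Fin 2))} (h : SmoothTriple D L E C τ)
    (h' : SmoothTriple D L E' C' τ') : SmoothTriple D L (E + E') (C + C') (τ + τ') := by
  obtain ⟨Φ, ⟨a₁, a₂, a₃⟩, b₁, b₂, b₃⟩ := h
  obtain ⟨Ψ, ⟨k₁, k₂, k₃⟩, m₁, m₂, m₃⟩ := h'
  refine ⟨Φ + Ψ, ⟨a₁.add k₁, a₂.add k₂, ?_⟩, ?_, ?_, ?_⟩
  · exact (a₃.union_left k₃).mono_left ((closure_mono (Function.support_add Φ Ψ)).trans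
      closure_union.subset)
  · filter_upwards [b₁, m₁, Lp.coeFn_add E E'] with x e₁ e₂ e₃
    rw [e₃, Pi.add_apply, e₁, e₂]; simp
  · filter_upwards [b₂, m₂, Lp.coeFn_add C C'] with x e₁ e₂ e₃
    rw [curl_add (a₁.differentiable (by simp)) (k₁.differentiable (by simp))]
    rw [e₃, Pi.add_apply, e₁, e₂]
  · filter_upwards [b₃, m₃, Lp.coeFn_add τ τ'] with x e₁ e₂ e₃
    rw [e₃, Pi.add_apply, e₁, e₂]; simp

lemma SmoothTriple.smul {D : Set (Cross 2)} {L : ℝ} {E C : Field D L}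
    {τ : L2 D (EuclideanSpace ℂ (Fin 2))} (c : ℂ) (h : SmoothTriple D L E C τ) :
    SmoothTriple D L (c • E) (c • C) (c • τ) := by
  obtain ⟨Φ, ⟨a₁, a₂, a₃⟩, b₁, b₂, b₃⟩ := h
  refine ⟨c • Φ, ⟨a₁.const_smul c, a₂.comp_left (g := fun y => c • y) (smul_zero c),
    a₃.mono_left (closure_mono (Function.support_const_smul_subset c Φ))⟩, ?_, ?_, ?_⟩
  · filter_upwards [b₁, Lp.coeFn_smul c E] with x e₁ e₃
    simp [e₁, e₃]
  · filter_upwards [b₂, Lp.coeFn_smul c C] with x e₁ e₃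
    rw [curl_smul c (a₁.differentiable (by simp))]
    simp [e₁, e₃]
  · filter_upwards [b₃, Lp.coeFn_smul c τ] with x e₁ e₃
    simp [e₁, e₃]

lemma OutCoeff.add {D : Set (Cross 2)} {L : ℝ} {w : L2 D (EuclideanSpace ℂ (Fin 2))}
    {E E' C C' : Field D L} {c c' : ℂ} (h : OutCoeff w E C c) (h' : OutCoeff w E' C' c') :
    OutCoeff w (E + E') (C + C') (c + c') :=
  map_mem_closure₂ (f := fun y y' : Field D L × Field D L × ℂ => y + y') continuous_add h h' (by
    rintro y ⟨τ, h₁, h₂⟩ y' ⟨τ', k₁, k₂⟩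
    exact ⟨τ + τ', h₁.add k₁, by simp [h₂, k₂, inner_add_right]⟩)

lemma OutCoeff.smul {D : Set (Cross 2)} {L : ℝ} {w : L2 D (EuclideanSpace ℂ (Fin 2))}
    {E C : Field D L} {c : ℂ} (r : ℂ) (h : OutCoeff w E C c) :
    OutCoeff w (r • E) (r • C) (r * c) :=
  map_mem_closure (f := fun y : Field D L × Field D L × ℂ => r • y) (continuous_const_smul r) h (by
    rintro y ⟨τ, h₁, h₂⟩
    exact ⟨r • τ, h₁.smul r, by simp [h₂, inner_smul_right]⟩)

lemma outCoeff_zero {D : Set (Cross 2)} {L : ℝ} (w : L2 D (EuclideanSpace ℂ (Fin 2))) :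
    OutCoeff (L := L) w 0 0 0 :=
  subset_closure ⟨0, smoothTriple_zero D L, by simp⟩

lemma OutflowMaxwell.add {D : Set (Cross 2)} {L : ℝ} {ω : ℝ}
    {gψ : ℕ → L2 D (EuclideanSpace ℂ (Fin 2))} {μ : ℕ → ℝ}
    {gφ : ℕ → L2 D (EuclideanSpace ℂ (Fin 2))} {l : ℕ → ℝ}
    {E cE H cH E' cE' H' cH' : Field D L} (h : OutflowMaxwell ω gψ μ gφ l E cE H cH)
    (h' : OutflowMaxwell ω gψ μ gφ l E' cE' H' cH') :
    OutflowMaxwell ω gψ μ gφ l (E + E') (cE + cE') (H + H') (cH + cH') := by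
  obtain ⟨α, β, h₁, h₂, h₃⟩ := h
  obtain ⟨α', β', k₁, k₂, k₃⟩ := h'
  refine ⟨α + α', β + β', fun i => (h₁ i).add (k₁ i), fun j => (h₂ j).add (k₂ j), ?_⟩
  intro G cG τ hG
  obtain ⟨s₁, s₂, e₁, e₂, e₃⟩ := h₃ G cG τ hG
  obtain ⟨s₁', s₂', e₁', e₂', e₃'⟩ := k₃ G cG τ hG
  refine ⟨s₁ + s₁', s₂ + s₂', ?_, ?_, ?_⟩
  · refine Eq.mp (congrArg (fun f : ℕ → ℂ => HasSum f (s₁ + s₁')) (funext fun n => ?_))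
      (e₁.add e₁')
    simp only [Pi.add_apply]; ring
  · refine Eq.mp (congrArg (fun f : ℕ → ℂ => HasSum f (s₂ + s₂')) (funext fun n => ?_))
      (e₂.add e₂')
    simp only [Pi.add_apply]; ring
  · rw [inner_add_right, inner_add_right]
    linear_combination e₃ + e₃'

lemma OutflowMaxwell.smul {D : Set (Cross 2)} {L : ℝ} {ω : ℝ}
    {gψ : ℕ → L2 D (EuclideanSpace ℂ (Fin 2))} {μ : ℕ → ℝ}
    {gφ : ℕ → L2 D (EuclideanSpace ℂ (Fin 2))} {l : ℕ → ℝ}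
    {E cE H cH : Field D L} (c : ℂ) (h : OutflowMaxwell ω gψ μ gφ l E cE H cH) :
    OutflowMaxwell ω gψ μ gφ l (c • E) (c • cE) (c • H) (c • cH) := by
  obtain ⟨α, β, h₁, h₂, h₃⟩ := h
  refine ⟨fun i => c * α i, fun j => c * β j, fun i => (h₁ i).smul c, fun j => (h₂ j).smul c, ?_⟩
  intro G cG τ hG
  obtain ⟨s₁, s₂, e₁, e₂, e₃⟩ := h₃ G cG τ hG
  refine ⟨c * s₁, c * s₂, ?_, ?_, ?_⟩
  · refine Eq.mp (congrArg (fun f : ℕ → ℂ => HasSum f (c * s₁)) (funext fun n => ?_))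
      (e₁.mul_left c)
    ring
  · refine Eq.mp (congrArg (fun f : ℕ → ℂ => HasSum f (c * s₂)) (funext fun n => ?_))
      (e₂.mul_left c)
    ring
  · rw [inner_smul_right, inner_smul_right]
    linear_combination c * e₃

lemma TangentialZero.add {D : Set (Cross 2)} {L : ℝ} {E C E' C' : Field D L}
    (h : TangentialZero E C) (h' : TangentialZero E' C') :
    TangentialZero (E + E') (C + C') := fun Φ hΦ => by
  rw [pairV_add _ _ (isWeight_curl axes3 hΦ.1 hΦ.2.1), pairV_add _ _ ⟨hΦ.1.continuous, hΦ.2.1⟩,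
    h Φ hΦ, h' Φ hΦ]

lemma TangentialZero.smul {D : Set (Cross 2)} {L : ℝ} {E C : Field D L} (c : ℂ)
    (h : TangentialZero E C) : TangentialZero (c • E) (c • C) := fun Φ hΦ => by
  rw [pairV_smul, pairV_smul, h Φ hΦ]

/-- The graph of `A^maxwell`. -/
def maxwellGraph (D : Set (Cross 2)) (L ω : ℝ)
    (gψ : ℕ → L2 D (EuclideanSpace ℂ (Fin 2))) (μ : ℕ → ℝ)
    (gφ : ℕ → L2 D (EuclideanSpace ℂ (Fin 2))) (l : ℕ → ℝ) :
    Submodule ℂ (MaxwellState D L × MaxwellState D L) where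
  carrier := {y | MaxwellRel D L ω gψ μ gφ l y}
  zero_mem' := by
    refine ⟨0, 0, ?_, ?_, ?_, ⟨0, 0, fun i => outCoeff_zero _, fun j => outCoeff_zero _, ?_⟩, ?_, ?_⟩
    · intro Φ _; simp [pairV_zero]
    · intro Φ _; simp [pairV_zero]
    · intro Φ _; simp [pairV_zero]
    · intro G cG τ _
      exact ⟨0, 0, by simp [hasSum_zero], by simp [hasSum_zero], by simp⟩
    · simp
    · simp
  add_mem' := by
    rintro y y' ⟨c, c', h₁, h₂, h₃, h₄, h₅, h₆⟩ ⟨r, r', k₁, k₂, k₃, k₄, k₅, k₆⟩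
    refine ⟨c + r, c' + r', h₁.add k₁, h₂.add k₂, h₃.add k₃, h₄.add k₄, ?_, ?_⟩
    · simp only [Prod.snd_add, Prod.fst_add, WithLp.add_fst, WithLp.add_snd, h₅, k₅, smul_add]
      abel
    · simp only [Prod.snd_add, Prod.fst_add, WithLp.add_fst, WithLp.add_snd, h₆, k₆, smul_add]
      abel
  smul_mem' := by
    rintro s y ⟨c, c', h₁, h₂, h₃, h₄, h₅, h₆⟩
    refine ⟨s • c, s • c', h₁.smul s, h₂.smul s, h₃.smul s, h₄.smul s, ?_, ?_⟩
    · simp only [Prod.smul_snd, Prod.smul_fst, WithLp.smul_fst, WithLp.smul_snd, h₅, smul_sub]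
      rw [smul_comm]
    · simp only [Prod.smul_snd, Prod.smul_fst, WithLp.smul_fst, WithLp.smul_snd, h₆, smul_add]
      rw [smul_comm]

lemma maxwellGraph_single {D : Set (Cross 2)} (hD : IsOpen D) (L ω : ℝ)
    (gψ : ℕ → L2 D (EuclideanSpace ℂ (Fin 2))) (μ : ℕ → ℝ)
    (gφ : ℕ → L2 D (EuclideanSpace ℂ (Fin 2))) (l : ℕ → ℝ) :
    ∀ y ∈ maxwellGraph D L ω gψ μ gφ l, y.1 = 0 → y.2 = 0 := by
  rintro ⟨u, F⟩ ⟨c, c', h₁, h₂, -, -, h₅, h₆⟩ rfl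
  have hc : c = 0 := HasWeakCurl.eq_zero (isOpen_guide hD L) h₁
  have hc' : c' = 0 := HasWeakCurl.eq_zero (isOpen_guide hD L) h₂
  subst hc hc'
  have hF : F.fst = 0 := by simpa using h₅
  have hf : F.snd = 0 := by simpa using h₆
  exact (WithLp.ofLp_injective 2) (Prod.ext hF hf)

/-- The Maxwell waveguide operator `A^maxwell` with domain `D(A^maxwell)`. -/
def maxwellOp (D : Set (Cross 2)) (L ω : ℝ)
    (gψ : ℕ → L2 D (EuclideanSpace ℂ (Fin 2))) (μ : ℕ → ℝ)
    (gφ : ℕ → L2 D (EuclideanSpace ℂ (Fin 2))) (l : ℕ → ℝ) :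
    MaxwellState D L →ₗ.[ℂ] MaxwellState D L :=
  (maxwellGraph D L ω gψ μ gφ l).toLinearPMap

/-- The graph of `maxwellOp` is the relation `MaxwellRel`. -/
theorem mem_graph_maxwellOp {D : Set (Cross 2)} (hD : IsOpen D) (L ω : ℝ)
    (gψ : ℕ → L2 D (EuclideanSpace ℂ (Fin 2))) (μ : ℕ → ℝ)
    (gφ : ℕ → L2 D (EuclideanSpace ℂ (Fin 2))) (l : ℕ → ℝ)
    (y : MaxwellState D L × MaxwellState D L) :
    y ∈ (maxwellOp D L ω gψ μ gφ l).graph ↔ MaxwellRel D L ω gψ μ gφ l y := by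
  rw [maxwellOp, Submodule.toLinearPMap_graph_eq _
    fun y hy h => maxwellGraph_single hD L ω gψ μ gφ l y hy h]
  rfl

end Operators

/-! ### The envelope operator and boundedness below -/

section Envelope

variable {d : ℕ} {D : Set (Cross d)} {L : ℝ}

lemma memLp_phase {F : Type*} [NormedAddCommGroup F] [NormedSpace ℂ F] {U : Set (Space d)}
    (k : ℝ) (f : L2 U F) :
    MemLp (fun x : Space d => Complex.exp (Complex.I * k * x.2) • f x) 2 (volume.restrict U) := by
  have h : Continuous fun x : Space d => Complex.exp (Complex.I * k * x.2) := by fun_prop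
  refine (memLp_congr_norm (h.aestronglyMeasurable.smul (Lp.memLp f).1) (Lp.memLp f).1 ?_).2
    (Lp.memLp f)
  refine Filter.Eventually.of_forall fun x => ?_
  rw [Pi.smul_apply', norm_smul, show Complex.I * k * x.2 = ((k * x.2 : ℝ) : ℂ) * Complex.I by push_cast; ring,
    Complex.norm_exp_ofReal_mul_I, one_mul]

/-- Multiplication by `e^{ikz}` on `L²(Ω; F)`. -/
def phase {F : Type*} [NormedAddCommGroup F] [NormedSpace ℂ F] {U : Set (Space d)} (k : ℝ) :
    L2 U F →ₗ[ℂ] L2 U F where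
  toFun f := (memLp_phase k f).toLp _
  map_add' f g := by
    refine Lp.ext ?_
    filter_upwards [(memLp_phase k (f + g)).coeFn_toLp, (memLp_phase k f).coeFn_toLp,
      (memLp_phase k g).coeFn_toLp, Lp.coeFn_add f g,
      Lp.coeFn_add ((memLp_phase k f).toLp _) ((memLp_phase k g).toLp _)] with x h₁ h₂ h₃ h₄ h₅
    rw [h₁, h₅, Pi.add_apply, h₂, h₃, h₄, Pi.add_apply, smul_add]
  map_smul' c f := by
    refine Lp.ext ?_
    filter_upwards [(memLp_phase k (c • f)).coeFn_toLp, (memLp_phase k f).coeFn_toLp,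
      Lp.coeFn_smul c f, Lp.coeFn_smul c ((memLp_phase k f).toLp _)] with x h₁ h₂ h₃ h₄
    rw [h₁, RingHom.id_apply, h₄, Pi.smul_apply, h₂, h₃, Pi.smul_apply, smul_comm]

/-- Multiplication by `e^{ikz}` on pairs of `L²(Ω)` functions or fields. -/
def phasePair {F G : Type*} [NormedAddCommGroup F] [NormedSpace ℂ F] [NormedAddCommGroup G]
    [NormedSpace ℂ G] {U : Set (Space d)} (k : ℝ) :
    WithLp 2 (L2 U F × L2 U G) →ₗ[ℂ] WithLp 2 (L2 U F × L2 U G) where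
  toFun y := WithLp.toLp 2 (phase k y.fst, phase k y.snd)
  map_add' y y' := by
    simp only [WithLp.add_fst, WithLp.add_snd, map_add]; rfl
  map_smul' c y := by
    simp only [WithLp.smul_fst, WithLp.smul_snd, map_smul]; rfl

/-- The full envelope operator `Ã ũ = e^{ikz} A (e^{-ikz} ũ)`, with domain
`D(Ã) = {ũ | e^{-ikz} ũ ∈ D(A)}`. -/
def envelope {F₁ G₁ F₂ G₂ : Type*} [NormedAddCommGroup F₁] [NormedSpace ℂ F₁]
    [NormedAddCommGroup G₁] [NormedSpace ℂ G₁] [NormedAddCommGroup F₂] [NormedSpace ℂ F₂]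
    [NormedAddCommGroup G₂] [NormedSpace ℂ G₂] {U : Set (Space d)} (k : ℝ)
    (A : WithLp 2 (L2 U F₁ × L2 U G₁) →ₗ.[ℂ] WithLp 2 (L2 U F₂ × L2 U G₂)) :
    WithLp 2 (L2 U F₁ × L2 U G₁) →ₗ.[ℂ] WithLp 2 (L2 U F₂ × L2 U G₂) where
  domain := A.domain.comap (phasePair (-k))
  toFun := phasePair k ∘ₗ A.toFun ∘ₗ (phasePair (-k)).restrict (fun _ hu => hu)

end Envelope

/-- `α ‖u‖ ≤ ‖A u‖` for all `u ∈ D(A)`. -/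
def IsBoundBelow {S T : Type*} [NormedAddCommGroup S] [NormedSpace ℂ S] [NormedAddCommGroup T]
    [NormedSpace ℂ T] (A : S →ₗ.[ℂ] T) (α : ℝ) : Prop :=
  ∀ u : A.domain, α * ‖(u : S)‖ ≤ ‖A u‖

/-- `A` is bounded below: `α ‖u‖ ≤ ‖A u‖` on `D(A)` for some `α > 0`. -/
def IsBoundedBelow {S T : Type*} [NormedAddCommGroup S] [NormedSpace ℂ S] [NormedAddCommGroup T]
    [NormedSpace ℂ T] (A : S →ₗ.[ℂ] T) : Prop :=
  ∃ α > 0, IsBoundBelow A α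

/-- The best boundedness-below constant `inf {‖A u‖ / ‖u‖ | 0 ≠ u ∈ D(A)}` (`∞` if `D(A) = 0`). -/
def boundBelowConst {S T : Type*} [NormedAddCommGroup S] [NormedSpace ℂ S] [NormedAddCommGroup T]
    [NormedSpace ℂ T] (A : S →ₗ.[ℂ] T) : ℝ≥0∞ :=
  ⨅ u : {u : A.domain // u ≠ 0}, ‖A u.1‖ₑ / ‖(u.1 : S)‖ₑ

end Waveguide

end

/-!
Multiplication by the phase `e^{ikz}` has modulus one pointwise, so it is an isometry of every
`L²(Ω; F)`, and hence of the spaces of pairs; its inverse is multiplication by `e^{-ikz}`. The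
envelope operator `Ã = e^{ikz} A e^{-ikz}` is therefore unitarily equivalent to `A`:
multiplication by `e^{-ikz}` maps `D(Ã)` bijectively onto `D(A)`, and preserves both `‖ũ‖` and
`‖Ã ũ‖` (`norm_envelope_apply`). Every quantity that depends only on the pairs of norms
`(‖u‖, ‖A u‖)`, `u ∈ D(A)`, is then the same for `Ã` and `A`.

Neither the differential expressions nor the boundary conditions enter: the argument applies to
an arbitrary linear operator between spaces of pairs of `L²` functions
(`isBoundBelow_envelope_iff`, `isBoundedBelow_envelope_iff`, `boundBelowConst_envelope`).
-/

namespace Waveguide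

section Phase

variable {d : ℕ} {U : Set (Space d)} {F G : Type*} [NormedAddCommGroup F] [NormedSpace ℂ F]
  [NormedAddCommGroup G] [NormedSpace ℂ G]

lemma coeFn_phase (k : ℝ) (f : L2 U F) :
    phase k f =ᵐ[volume.restrict U] fun x => Complex.exp (Complex.I * k * x.2) • f x :=
  (memLp_phase k f).coeFn_toLp

lemma norm_phase (k : ℝ) (f : L2 U F) : ‖phase k f‖ = ‖f‖ := by
  rw [Lp.norm_def, Lp.norm_def]
  congr 1
  refine eLpNorm_congr_norm_ae ?_
  filter_upwards [coeFn_phase k f] with x hx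
  rw [hx, norm_smul, show Complex.I * k * x.2 = ((k * x.2 : ℝ) : ℂ) * Complex.I by
    push_cast; ring, Complex.norm_exp_ofReal_mul_I, one_mul]

lemma phase_phase (k m : ℝ) (f : L2 U F) : phase k (phase m f) = phase (k + m) f := by
  refine Lp.ext ?_
  filter_upwards [coeFn_phase k (phase m f), coeFn_phase m f, coeFn_phase (k + m) f]
    with x h₁ h₂ h₃
  rw [h₁, h₂, h₃, smul_smul, ← Complex.exp_add]
  congr 2
  push_cast
  ring

lemma phase_zero (f : L2 U F) : phase 0 f = f := by
  refine Lp.ext ?_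
  filter_upwards [coeFn_phase 0 f] with x hx
  simp [hx]

lemma norm_phasePair (k : ℝ) (y : WithLp 2 (L2 U F × L2 U G)) : ‖phasePair k y‖ = ‖y‖ := by
  rw [WithLp.prod_norm_eq_of_L2, WithLp.prod_norm_eq_of_L2]
  change √(‖phase k y.fst‖ ^ 2 + ‖phase k y.snd‖ ^ 2) = _
  rw [norm_phase, norm_phase]

lemma phasePair_phasePair_of_add_eq_zero {k m : ℝ} (h : k + m = 0)
    (y : WithLp 2 (L2 U F × L2 U G)) : phasePair k (phasePair m y) = y := by
  refine WithLp.ofLp_injective 2 (Prod.ext ?_ ?_)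
  · change phase k (phase m y.fst) = y.fst
    rw [phase_phase, h, phase_zero]
  · change phase k (phase m y.snd) = y.snd
    rw [phase_phase, h, phase_zero]

end Phase

section EnvelopeBounds

variable {d : ℕ} {U : Set (Space d)} {F₁ G₁ F₂ G₂ : Type*}
  [NormedAddCommGroup F₁] [NormedSpace ℂ F₁] [NormedAddCommGroup G₁] [NormedSpace ℂ G₁]
  [NormedAddCommGroup F₂] [NormedSpace ℂ F₂] [NormedAddCommGroup G₂] [NormedSpace ℂ G₂]
  (k : ℝ) (A : WithLp 2 (L2 U F₁ × L2 U G₁) →ₗ.[ℂ] WithLp 2 (L2 U F₂ × L2 U G₂))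

lemma mem_envelope_domain (u : WithLp 2 (L2 U F₁ × L2 U G₁)) :
    u ∈ (envelope k A).domain ↔ phasePair (-k) u ∈ A.domain :=
  Iff.rfl

lemma phasePair_mem_envelope_domain (u : A.domain) :
    phasePair k (u : WithLp 2 (L2 U F₁ × L2 U G₁)) ∈ (envelope k A).domain := by
  rw [mem_envelope_domain, phasePair_phasePair_of_add_eq_zero (neg_add_cancel k)]
  exact u.2

/-- Multiplication by `e^{-ikz}` as a bijection from `D(Ã)` onto `D(A)`. -/
noncomputable def envelopeDomainEquiv : (envelope k A).domain ≃ A.domain where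
  toFun u := ⟨phasePair (-k) (u : WithLp 2 (L2 U F₁ × L2 U G₁)),
    (mem_envelope_domain k A _).1 u.2⟩
  invFun u := ⟨phasePair k (u : WithLp 2 (L2 U F₁ × L2 U G₁)),
    phasePair_mem_envelope_domain k A u⟩
  left_inv _ := Subtype.ext (phasePair_phasePair_of_add_eq_zero (add_neg_cancel k) _)
  right_inv _ := Subtype.ext (phasePair_phasePair_of_add_eq_zero (neg_add_cancel k) _)

lemma envelope_apply (u : (envelope k A).domain) :
    envelope k A u = phasePair k (A (envelopeDomainEquiv k A u)) :=
  rfl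

lemma norm_envelope_apply (u : (envelope k A).domain) :
    ‖envelope k A u‖ = ‖A (envelopeDomainEquiv k A u)‖ := by
  rw [envelope_apply, norm_phasePair]

lemma norm_envelopeDomainEquiv (u : (envelope k A).domain) :
    ‖(envelopeDomainEquiv k A u : WithLp 2 (L2 U F₁ × L2 U G₁))‖
      = ‖(u : WithLp 2 (L2 U F₁ × L2 U G₁))‖ :=
  norm_phasePair (-k) _

lemma envelopeDomainEquiv_ne_zero_iff (u : (envelope k A).domain) :
    envelopeDomainEquiv k A u ≠ 0 ↔ u ≠ 0 := by
  rw [Ne, Ne, ← ZeroMemClass.coe_eq_zero, ← ZeroMemClass.coe_eq_zero, ← norm_eq_zero,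
    norm_envelopeDomainEquiv, norm_eq_zero]

lemma isBoundBelow_envelope_iff (α : ℝ) :
    IsBoundBelow (envelope k A) α ↔ IsBoundBelow A α := by
  refine (envelopeDomainEquiv k A).forall_congr fun u => ?_
  rw [norm_envelope_apply, norm_envelopeDomainEquiv]

lemma isBoundedBelow_envelope_iff : IsBoundedBelow (envelope k A) ↔ IsBoundedBelow A :=
  exists_congr fun α => and_congr_right fun _ => isBoundBelow_envelope_iff k A α

lemma boundBelowConst_envelope : boundBelowConst (envelope k A) = boundBelowConst A := by
  refine Equiv.iInf_congr ((envelopeDomainEquiv k A).subtypeEquiv fun u =>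
    (envelopeDomainEquiv_ne_zero_iff k A u).symm) fun u => ?_
  rw [Equiv.subtypeEquiv_apply, ← ofReal_norm, ← ofReal_norm, ← norm_envelope_apply,
    norm_envelopeDomainEquiv, ofReal_norm, ofReal_norm]

end EnvelopeBounds

end Waveguide

theorem mainTheorem9 (L ω k : ℝ) (hL : 0 < L) (hω : 0 < ω) :
    -- the acoustic waveguide
    (∀ (d : ℕ) (D : Set (Waveguide.Cross d)), Waveguide.IsBoundedLipschitzDomain D →
      ∀ a : Waveguide.Cross d → Matrix (Fin d) (Fin d) ℝ, Waveguide.IsElliptic D a →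
      ∀ (φ : ℕ → Waveguide.L2 D ℂ × Waveguide.L2 D (EuclideanSpace ℂ (Fin d))) (l : ℕ → ℝ),
        Waveguide.ListsEigenpairs (Waveguide.H1 D) a Set.univ φ l →
        Orthonormal ℂ (fun n => (φ n).1) →
      ∀ σ : ℝ, σ = 1 ∨ σ = -1 →
      ∀ A, A = Waveguide.helmOp D L σ ω a (fun n => (φ n).1) l →
        (∀ α : ℝ, Waveguide.IsBoundBelow (Waveguide.envelope k A) α ↔
          Waveguide.IsBoundBelow A α) ∧
        (Waveguide.IsBoundedBelow (Waveguide.envelope k A) ↔ Waveguide.IsBoundedBelow A) ∧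
        Waveguide.boundBelowConst (Waveguide.envelope k A) = Waveguide.boundBelowConst A) ∧
    -- the Maxwell waveguide
    (∀ D : Set (Waveguide.Cross 2), Waveguide.IsBoundedLipschitzDomain D →
      ∀ (ψ φ : ℕ → Waveguide.L2 D ℂ × Waveguide.L2 D (EuclideanSpace ℂ (Fin 2)))
        (μ l : ℕ → ℝ),
        Waveguide.ListsEigenpairs (Waveguide.H1 D) (fun _ => 1) (Set.Ioi 0) ψ μ →
        Orthonormal ℂ (fun i => (ψ i).2) →
        Waveguide.ListsEigenpairs (Waveguide.H10 D) (fun _ => 1) (Set.Ioi 0) φ l →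
        Orthonormal ℂ (fun j => (φ j).2) →
        (∀ j, l j ≠ ω ^ 2) →
      ∀ A, A = Waveguide.maxwellOp D L ω (fun i => (ψ i).2) μ (fun j => (φ j).2) l →
        (∀ α : ℝ, Waveguide.IsBoundBelow (Waveguide.envelope k A) α ↔
          Waveguide.IsBoundBelow A α) ∧
        (Waveguide.IsBoundedBelow (Waveguide.envelope k A) ↔ Waveguide.IsBoundedBelow A) ∧
        Waveguide.boundBelowConst (Waveguide.envelope k A) = Waveguide.boundBelowConst A) := by
  constructor
  · intro d D _ a _ φ l _ _ σ _ A _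
    exact ⟨Waveguide.isBoundBelow_envelope_iff k A, Waveguide.isBoundedBelow_envelope_iff k A,
      Waveguide.boundBelowConst_envelope k A⟩
  · intro D _ ψ φ μ l _ _ _ _ _ A _
    exact ⟨Waveguide.isBoundBelow_envelope_iff k A, Waveguide.isBoundedBelow_envelope_iff k A,
      Waveguide.boundBelowConst_envelope k A⟩
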